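/- Let $1<p<\infty$, $0<s<1$, $\frac1p+\frac1{p'}=1$ and $N>sp$, and let $\Omega\subset\mathbb R^N$ be a bounded $C^1$ domain (nonempty, open, connected, bounded, and locally near each boundary point the region on one side of the graph of a $C^1$ function). Let $f\in L^{p'}(\Omega)$ and let $g\in L^\infty_c(\mathbb R^N\setminus\Omega)$, i.e. $g$ is an essentially bounded measurable function on $\mathbb R^N\setminus\Omega$ that vanishes almost everywhere outside some compact set. Put $Q(\Omega)=\mathbb R^{2N}\setminus(\mathbb R^N\setminus\Omega)^2$ and let $W$ be the space of measurable functions $u:\mathbb R^N\to\mathbb R$ with $$\|u\|_W=\left(\int_\Omega|u|^p\,dx+\iint_{Q(\Omega)}\frac{|u(x)-u(y)|^p}{|x-y|^{N+sp}}\,dx\,dy+\int_{\mathbb R^N\setminus\Omega}|g||u|^p\,dx\right)^{1/p}<\infty .$$ A weak solution of the fractional $p$-Laplacian Neumann problem $$(-\Delta)^s_pu=f\ \text{ in }\Omega,\qquad \mathcal N_{s,p}u=g\ \text{ in }\mathbb R^N\setminus\overline\Omega$$ is a function $u\in W$ such that for every $v\in W$ (all integrals being absolutely convergent) $$\frac12\iint_{Q(\Omega)}\frac{|u(x)-u(y)|^{p-2}(u(x)-u(y))(v(x)-v(y))}{|x-y|^{N+sp}}\,dx\,dy=\int_\Omega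 fv\,dx+\int_{\mathbb R^N\setminus\Omega}gv\,dx .$$ Then a weak solution exists if and only if $$\int_\Omega f\,dx+\int_{\mathbb R^N\setminus\Omega}g\,dx=0 .$$ Moreover, the weak solution is unique up to additive real constants: if $u$ is a weak solution, then a function $w:\mathbb R^N\to\mathbb R$ is a weak solution if and only if there is $c\in\mathbb R$ with $w=u+c$ almost everywhere in $\mathbb R^N$. -/

import Mathlib

open MeasureTheory

namespace FracNeumann

/-- `Ω ⊆ ℝ^N` is a bounded `C¹` domain: a bounded, nonempty, connected open set such that near every
boundary point `x₀` there are a unit vector `ν` and a `C¹` function `γ` on the hyperplane orthogonal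
to `ν` for which, in a ball around `x₀`, the set `Ω` is the region strictly above the graph of `γ`
(heights being measured in the direction `ν`). -/
structure IsBoundedC1Domain {N : ℕ} (Ω : Set (EuclideanSpace ℝ (Fin N))) : Prop where
  isOpen : IsOpen Ω
  isConnected : IsConnected Ω
  isBounded : Bornology.IsBounded Ω
  boundary : ∀ x₀ ∈ frontier Ω,
    ∃ r : ℝ, 0 < r ∧ ∃ ν : EuclideanSpace ℝ (Fin N), ‖ν‖ = 1 ∧
      ∃ γ : ((Submodule.span ℝ {ν})ᗮ : Submodule ℝ (EuclideanSpace ℝ (Fin N))) → ℝ,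
        ContDiff ℝ 1 γ ∧
        ∀ x ∈ Metric.ball x₀ r,
          (x ∈ Ω ↔ γ ((Submodule.span ℝ {ν})ᗮ.orthogonalProjectionOnto x) < inner ℝ ν x)

/-- `Q(Ω) = ℝ^{2N} ∖ (ℝ^N ∖ Ω)²`. -/
def Q {N : ℕ} (Ω : Set (EuclideanSpace ℝ (Fin N))) :
    Set (EuclideanSpace ℝ (Fin N) × EuclideanSpace ℝ (Fin N)) :=
  (Ωᶜ ×ˢ Ωᶜ)ᶜ

/-- The norm
`(∫_Ω |u|^p + ∬_{Q(Ω)} |u(x) - u(y)|^p / |x - y|^{N+sp} + ∫_{ℝ^N ∖ Ω} |g| |u|^p)^{1/p}`,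
with values in `[0, ∞]`. -/
noncomputable def eNormW {N : ℕ} (Ω : Set (EuclideanSpace ℝ (Fin N))) (s p : ℝ)
    (g u : EuclideanSpace ℝ (Fin N) → ℝ) : ENNReal :=
  ((∫⁻ x in Ω, ‖u x‖ₑ ^ p)
    + (∫⁻ z in Q Ω, ‖u z.1 - u z.2‖ₑ ^ p / ‖z.1 - z.2‖ₑ ^ ((N : ℝ) + s * p))
    + (∫⁻ x in Ωᶜ, ‖g x‖ₑ * ‖u x‖ₑ ^ p)) ^ (1 / p)

/-- The space `W^{s,p}_{𝒩(g)}(Ω)` of all (Lebesgue) measurable functions `u : ℝ^N → ℝ` of finite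
norm. Lebesgue measurability is `AEMeasurable` with respect to the Lebesgue measure. -/
def SpaceW {N : ℕ} (Ω : Set (EuclideanSpace ℝ (Fin N))) (s p : ℝ)
    (g : EuclideanSpace ℝ (Fin N) → ℝ) : Set (EuclideanSpace ℝ (Fin N) → ℝ) :=
  {u | AEMeasurable u volume ∧ eNormW Ω s p g u < ⊤}

/-- The integrand of the weak form,
`|u(x) - u(y)|^{p-2} (u(x) - u(y)) (v(x) - v(y)) / |x - y|^{N+sp}` at `z = (x, y)`. At points with
`u(x) = u(y)` it is `0` for every `p`, as it should be. -/
noncomputable def weakIntegrand {N : ℕ} (s p : ℝ) (u v : EuclideanSpace ℝ (Fin N) → ℝ)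
    (z : EuclideanSpace ℝ (Fin N) × EuclideanSpace ℝ (Fin N)) : ℝ :=
  |u z.1 - u z.2| ^ (p - 2) * (u z.1 - u z.2) * (v z.1 - v z.2)
    / ‖z.1 - z.2‖ ^ ((N : ℝ) + s * p)

/-- `u` is a weak solution of the Neumann problem `(-Δ)^s_p u = f` in `Ω`, `𝒩_{s,p} u = g` in
`ℝ^N ∖ closure Ω`: it lies in `W^{s,p}_{𝒩(g)}(Ω)` and satisfies the weak formulation for every test
function in that space, all three integrals being absolutely convergent. -/
def IsWeakSolution {N : ℕ} (Ω : Set (EuclideanSpace ℝ (Fin N))) (s p : ℝ)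
    (f g u : EuclideanSpace ℝ (Fin N) → ℝ) : Prop :=
  u ∈ SpaceW Ω s p g ∧ ∀ v ∈ SpaceW Ω s p g,
    IntegrableOn (weakIntegrand s p u v) (Q Ω) ∧
    IntegrableOn (fun x => f x * v x) Ω ∧
    IntegrableOn (fun x => g x * v x) Ωᶜ ∧
    (1 / 2 : ℝ) * (∫ z in Q Ω, weakIntegrand s p u v z)
      = (∫ x in Ω, f x * v x) + (∫ x in Ωᶜ, g x * v x)

end FracNeumann

/-! Write `b = N + s * p` and let `Du(x, y) = (u(x) - u(y)) / |x - y|^(b/p)`, the function `diffQuot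
(b / p) u`. Everything is transferred to `L^p(Q(Ω))`. Since `Q(Ω)` contains `Ω × ℝ^N`, Fubini gives
a point `x` for which `Du(x, ·)` carries information on almost every `y` of the whole space. Hence
`Du ∈ L^p` forces `u ∈ L^p` on bounded sets, so `W` is just the set of measurable `u` with `Du ∈
L^p` (`mem_SpaceW_iff`). The same slicing shows that the range of `D` is closed
(`isClosed_diffQuotRange`) and that `Du = 0` only for constants.

Let `h` be `f` on `Ω` and `g` outside. Testing with `v = 1` gives the necessity of `∫ h = 0`.
Conversely, if `∫ h = 0`, averaging `h(y)(v(x) - v(y))` over `x ∈ Ω` writes `∫ h v` as the pairing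
of `Dv` with a fixed `L^{p'}` function (`exists_diffQuot_representation`). The data thus become a
bounded functional `L` on `L^p(Q(Ω))`, and a solution is a minimizer of `‖U‖^p / p - L U` over the
range of `D` (`exists_duality_representative`). Uniform convexity makes minimizing sequences Cauchy,
so the argument needs neither a Poincaré inequality nor weak compactness.

Uniqueness follows from the strict monotonicity of `t ↦ |t|^{p-2} t`. -/

namespace FracNeumann

open Filter Topology

/-! ### Convexity and monotonicity of the scalar power `|t|^p` -/

section PowerFunction

/-- If `|x| ≠ |y|`, strictness comes from `t^p` on `[0, ∞)`; if `y = -x`, it comes from cancellation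
in the triangle inequality. -/
theorem strictConvexOn_abs_rpow {p : ℝ} (hp : 1 < p) :
    StrictConvexOn ℝ Set.univ (fun x : ℝ => |x| ^ p) := by
  refine ⟨convex_univ, fun x _ y _ hxy a b ha hb hab => ?_⟩
  simp only [smul_eq_mul]
  have htri : |a * x + b * y| ≤ a * |x| + b * |y| := by
    calc |a * x + b * y| ≤ |a * x| + |b * y| := abs_add_le _ _
      _ = a * |x| + b * |y| := by rw [abs_mul, abs_mul, abs_of_pos ha, abs_of_pos hb]
  by_cases h : |x| = |y|
  · have hy : y = -x := by
      rcases abs_eq_abs.1 h with h | h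
      · exact absurd h hxy
      · rw [h, neg_neg]
    have hx : x ≠ 0 := by
      rintro rfl
      exact hxy (by simp [hy])
    have hlt : |a * x + b * y| < |x| := by
      have hx' : 0 < |x| := abs_pos.2 hx
      have : a * x + b * y = (a - b) * x := by rw [hy]; ring
      rw [this, abs_mul]
      have : |a - b| < 1 := by rw [abs_lt]; constructor <;> linarith
      nlinarith
    have := Real.rpow_lt_rpow (abs_nonneg _) hlt (by linarith : 0 < p)
    rw [← h, ← add_mul, hab, one_mul]
    exact this
  · have h1 := (strictConvexOn_rpow hp).2 (abs_nonneg x) (abs_nonneg y) h ha hb hab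
    simp only [smul_eq_mul] at h1
    exact lt_of_le_of_lt (Real.rpow_le_rpow (abs_nonneg _) htri (by linarith)) h1

theorem continuous_abs_rpow {p : ℝ} (hp : 1 < p) : Continuous (fun x : ℝ => |x| ^ p) :=
  continuous_abs.rpow_const fun _ => Or.inr (by linarith)

theorem abs_midpoint_rpow_le {p : ℝ} (hp : 1 < p) (a b : ℝ) :
    |(a + b) / 2| ^ p ≤ (|a| ^ p + |b| ^ p) / 2 := by
  have := (strictConvexOn_abs_rpow hp).convexOn.2 (Set.mem_univ a) (Set.mem_univ b)
    (by norm_num : (0 : ℝ) ≤ 1 / 2) (by norm_num : (0 : ℝ) ≤ 1 / 2) (by norm_num)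
  simp only [smul_eq_mul] at this
  calc |(a + b) / 2| ^ p = |1 / 2 * a + 1 / 2 * b| ^ p := by congr 2; ring
    _ ≤ _ := this
    _ = _ := by ring

theorem abs_midpoint_rpow_lt {p : ℝ} (hp : 1 < p) {a b : ℝ} (hab : a ≠ b) :
    |(a + b) / 2| ^ p < (|a| ^ p + |b| ^ p) / 2 := by
  have := (strictConvexOn_abs_rpow hp).2 (Set.mem_univ a) (Set.mem_univ b) hab
    (by norm_num : (0 : ℝ) < 1 / 2) (by norm_num : (0 : ℝ) < 1 / 2) (by norm_num)
  simp only [smul_eq_mul] at this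
  calc |(a + b) / 2| ^ p = |1 / 2 * a + 1 / 2 * b| ^ p := by congr 2; ring
    _ < _ := this
    _ = _ := by ring

/-- The derivative `p |a|^{p-2} a` of `|a|^p` is strictly monotone. -/
theorem strictMono_abs_rpow_mul {p : ℝ} (hp : 1 < p) :
    StrictMono (fun a : ℝ => |a| ^ (p - 2) * a) := by
  intro a b hab
  have h1 := (strictConvexOn_abs_rpow hp).lt_slope_of_hasDerivAt (Set.mem_univ a)
    (Set.mem_univ b) hab (hasDerivAt_abs_rpow a hp)
  have h2 := (strictConvexOn_abs_rpow hp).slope_lt_of_hasDerivAt (Set.mem_univ a)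
    (Set.mem_univ b) hab (hasDerivAt_abs_rpow b hp)
  have h3 := h1.trans h2
  rw [mul_assoc, mul_assoc] at h3
  exact lt_of_mul_lt_mul_left h3 (by linarith)

theorem monotone_pairing_nonneg {p : ℝ} (hp : 1 < p) (a b : ℝ) :
    0 ≤ (|a| ^ (p - 2) * a - |b| ^ (p - 2) * b) * (a - b) := by
  rcases lt_trichotomy a b with h | h | h
  · exact (mul_pos_of_neg_of_neg (sub_neg.2 (strictMono_abs_rpow_mul hp h)) (sub_neg.2 h)).le
  · simp [h]
  · exact (mul_pos (sub_pos.2 (strictMono_abs_rpow_mul hp h)) (sub_pos.2 h)).le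

theorem eq_of_monotone_pairing_eq_zero {p : ℝ} (hp : 1 < p) {a b : ℝ}
    (h : (|a| ^ (p - 2) * a - |b| ^ (p - 2) * b) * (a - b) = 0) : a = b := by
  rcases mul_eq_zero.1 h with h | h
  · exact (strictMono_abs_rpow_mul hp).injective (sub_eq_zero.1 h)
  · exact sub_eq_zero.1 h

theorem abs_abs_rpow_mul {p : ℝ} (hp : 1 < p) (a : ℝ) :
    |(|a| ^ (p - 2) * a)| = |a| ^ (p - 1) := by
  rcases eq_or_ne a 0 with rfl | h
  · simp [Real.zero_rpow (by linarith : p - 1 ≠ 0)]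
  · rw [abs_mul, abs_of_nonneg (by positivity : 0 ≤ |a| ^ (p - 2)),
      show p - 1 = (p - 2) + 1 by ring, Real.rpow_add (abs_pos.2 h), Real.rpow_one]

/-- A homogeneous form of the uniform convexity of `|·|^p`. -/
theorem exists_abs_sub_rpow_le {p : ℝ} (hp : 1 < p) {ε : ℝ} (hε : 0 < ε) :
    ∃ C : ℝ, 0 ≤ C ∧ ∀ a b : ℝ, |a - b| ^ p ≤
      ε * (|a| ^ p + |b| ^ p) + C * ((|a| ^ p + |b| ^ p) / 2 - |(a + b) / 2| ^ p) := by
  have hp0 : 0 < p := by linarith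
  let gap : ℝ × ℝ → ℝ := fun x => (|x.1| ^ p + |x.2| ^ p) / 2 - |(x.1 + x.2) / 2| ^ p
  -- The inequality is homogeneous of degree `p`, so it suffices to treat the sphere `|a|^p + |b|^p
  -- = 1`. On the compact part where `|a - b|^p ≥ ε` the convexity gap has a positive minimum `δ`;
  -- elsewhere the `ε` term alone suffices.
  let K : Set (ℝ × ℝ) := {x | |x.1| ^ p + |x.2| ^ p = 1 ∧ ε ≤ |x.1 - x.2| ^ p}
  have hc := continuous_abs_rpow hp
  have hgap : Continuous gap :=
    (((hc.comp continuous_fst).add (hc.comp continuous_snd)).div_const 2).sub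
      (hc.comp ((continuous_fst.add continuous_snd).div_const 2))
  have hle1 : ∀ x y : ℝ, |x| ^ p + |y| ^ p = 1 → |x| ≤ 1 := by
    intro x y h
    by_contra! hx
    have h1 : 1 < |x| ^ p := Real.one_lt_rpow hx hp0
    have h2 : 0 ≤ |y| ^ p := by positivity
    linarith
  have hK : IsCompact K := by
    refine Metric.isCompact_of_isClosed_isBounded ?_ ?_
    · exact (isClosed_eq ((hc.comp continuous_fst).add (hc.comp continuous_snd))
        continuous_const).inter
        (isClosed_le continuous_const (hc.comp (continuous_fst.sub continuous_snd)))
    · refine (Metric.isBounded_closedBall (x := (0 : ℝ × ℝ)) (r := 1)).subset fun x hx => ?_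
      rw [mem_closedBall_zero_iff, Prod.norm_def]
      exact max_le (hle1 _ _ hx.1) (hle1 _ _ ((add_comm _ _).trans hx.1))
  have hpos : ∀ x ∈ K, 0 < gap x := by
    intro x hx
    have : x.1 ≠ x.2 := by
      intro h
      have h2 := hx.2
      rw [h, sub_self, abs_zero, Real.zero_rpow hp0.ne'] at h2
      linarith
    exact sub_pos.2 (abs_midpoint_rpow_lt hp this)
  obtain ⟨δ, hδ, hδK⟩ : ∃ δ : ℝ, 0 < δ ∧ ∀ x ∈ K, δ ≤ gap x := by
    rcases K.eq_empty_or_nonempty with h | h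
    · exact ⟨1, one_pos, by simp [h]⟩
    · obtain ⟨x, hx, hmin⟩ := hK.exists_isMinOn h hgap.continuousOn
      exact ⟨gap x, hpos x hx, fun y hy => hmin hy⟩
  -- On the sphere `|a - b|^p ≤ 2^p`, while the gap is at least `δ` on `K`.
  refine ⟨2 ^ p / δ, by positivity, fun a b => ?_⟩
  have hgap0 : 0 ≤ (|a| ^ p + |b| ^ p) / 2 - |(a + b) / 2| ^ p :=
    sub_nonneg.2 (abs_midpoint_rpow_le hp a b)
  set S : ℝ := |a| ^ p + |b| ^ p with hS
  have hS0 : 0 ≤ S := by positivity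
  rcases hS0.eq_or_lt with h0 | hSpos
  · have ha : |a| ^ p = 0 := by
      have : 0 ≤ |a| ^ p := by positivity
      have : 0 ≤ |b| ^ p := by positivity
      linarith
    have hb : |b| ^ p = 0 := by linarith
    have ha' : a = 0 := by simpa [hp0.ne'] using (Real.rpow_eq_zero (abs_nonneg a) hp0.ne').1 ha
    have hb' : b = 0 := by simpa [hp0.ne'] using (Real.rpow_eq_zero (abs_nonneg b) hp0.ne').1 hb
    rw [← h0, ha', hb']
    simp [Real.zero_rpow hp0.ne']
  · set t : ℝ := S ^ (1 / p) with ht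
    have htpos : 0 < t := by positivity
    have htp : t ^ p = S := by
      rw [ht, ← Real.rpow_mul hS0, one_div_mul_cancel hp0.ne', Real.rpow_one]
    have hdiv : ∀ x : ℝ, |x / t| ^ p = |x| ^ p / S := by
      intro x
      rw [abs_div, abs_of_pos htpos, Real.div_rpow (abs_nonneg _) htpos.le, htp]
    have hsum : |a / t| ^ p + |b / t| ^ p = 1 := by
      rw [hdiv, hdiv, ← add_div, ← hS, div_self hSpos.ne']
    by_cases hmem : (a / t, b / t) ∈ K
    · have h1 := hδK _ hmem
      have h2 : gap (a / t, b / t) = (S / 2 - |(a + b) / 2| ^ p) / S := by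
        simp only [gap]
        rw [hsum, show (a / t + b / t) / 2 = ((a + b) / 2) / t by ring, hdiv]
        field_simp
      have h3 : |a / t - b / t| ^ p ≤ 2 ^ p := by
        refine Real.rpow_le_rpow (abs_nonneg _) ?_ hp0.le
        have := abs_sub (a / t) (b / t)
        linarith [hle1 _ _ hsum, hle1 _ _ ((add_comm _ _).trans hsum)]
      rw [← sub_div, hdiv, div_le_iff₀ hSpos] at h3
      rw [h2, le_div_iff₀ hSpos] at h1
      calc |a - b| ^ p ≤ 2 ^ p * S := h3
        _ = 2 ^ p / δ * (δ * S) := by field_simp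
        _ ≤ 2 ^ p / δ * (S / 2 - |(a + b) / 2| ^ p) := by gcongr
        _ ≤ _ := by nlinarith
    · have h1 : |a / t - b / t| ^ p < ε := by
        by_contra! h
        exact hmem ⟨hsum, h⟩
      rw [← sub_div, hdiv, div_lt_iff₀ hSpos] at h1
      have : 0 ≤ 2 ^ p / δ * (S / 2 - |(a + b) / 2| ^ p) := by positivity
      linarith

/-- Superlinear growth of `t^p` absorbs a linear term; this is the coercivity of the energy. Beyond
the threshold `T` one has `t^p / p ≥ (c + 1) t`. -/
theorem exists_sub_le_rpow_div_sub {p : ℝ} (hp : 1 < p) {c : ℝ} (hc : 0 ≤ c) :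
    ∃ B : ℝ, ∀ t : ℝ, 0 ≤ t → t - B ≤ t ^ p / p - c * t := by
  have hp0 : 0 < p := by linarith
  set T : ℝ := (p * (c + 1)) ^ (1 / (p - 1)) with hT
  have hT0 : 0 < T := by positivity
  have hTp : T ^ (p - 1) = p * (c + 1) := by
    rw [hT, ← Real.rpow_mul (by positivity), one_div_mul_cancel (by linarith), Real.rpow_one]
  refine ⟨(c + 1) * T, fun t ht => ?_⟩
  rcases le_total t T with h | h
  · have : 0 ≤ t ^ p / p := by positivity
    nlinarith
  · have htpos : 0 < t := hT0.trans_le h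
    have h1 : p * (c + 1) ≤ t ^ (p - 1) := hTp ▸ Real.rpow_le_rpow hT0.le h (by linarith)
    have h2 : t ^ p = t ^ (p - 1) * t := by
      rw [← Real.rpow_add_one htpos.ne']; congr 1; ring
    have h3 : (c + 1) * t ≤ t ^ p / p := by
      rw [le_div_iff₀ hp0, h2]
      nlinarith
    nlinarith

end PowerFunction

/-! ### Energy minimization on closed subspaces of `L^p` -/

section Minimization

variable {α : Type*} [MeasurableSpace α] {μ : Measure α}

theorem Lp_norm_rpow_eq_integral {p : ℝ} (hp : 1 < p) (U : Lp ℝ (ENNReal.ofReal p) μ) :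
    ‖U‖ ^ p = ∫ x, |U x| ^ p ∂μ := by
  have hp0 : 0 < p := by linarith
  rw [Lp.norm_def, (Lp.memLp U).eLpNorm_eq_integral_rpow_norm (by simpa using hp0)
    ENNReal.ofReal_ne_top, ENNReal.toReal_ofReal hp0.le, ENNReal.toReal_ofReal (by positivity),
    ← Real.rpow_mul (by positivity), inv_mul_cancel₀ hp0.ne', Real.rpow_one]
  rfl

theorem integrable_abs_rpow {p : ℝ} (hp : 1 < p) {U : α → ℝ}
    (hU : MemLp U (ENNReal.ofReal p) μ) : Integrable (fun x => |U x| ^ p) μ := by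
  have hp0 : 0 < p := by linarith
  simpa [ENNReal.toReal_ofReal hp0.le] using
    hU.integrable_norm_rpow (by simpa using hp0) ENNReal.ofReal_ne_top

theorem holderTriple_ofReal {p q : ℝ} (h : p.HolderConjugate q) :
    ENNReal.HolderTriple (ENNReal.ofReal p) (ENNReal.ofReal q) 1 := by
  constructor
  rw [← ENNReal.ofReal_inv_of_pos h.pos, ← ENNReal.ofReal_inv_of_pos h.symm.pos,
    ← ENNReal.ofReal_add (inv_nonneg.2 h.nonneg) (inv_nonneg.2 h.symm.nonneg),
    h.inv_add_inv_eq_one]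
  simp

theorem aestronglyMeasurable_abs_rpow_mul {p : ℝ} {U : α → ℝ} (hU : AEStronglyMeasurable U μ) :
    AEStronglyMeasurable (fun x => |U x| ^ (p - 2) * U x) μ := by
  have h := hU.aemeasurable
  exact ((measurable_norm.comp_aemeasurable h).pow_const (p - 2)).mul h |>.aestronglyMeasurable

/-- The modulus is `|U|^{p-1}`, and `q = p / (p - 1)`. -/
theorem memLp_abs_rpow_mul {p q : ℝ} (h : p.HolderConjugate q) {U : α → ℝ}
    (hU : MemLp U (ENNReal.ofReal p) μ) :
    MemLp (fun x => |U x| ^ (p - 2) * U x) (ENNReal.ofReal q) μ := by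
  have h1 := hU.norm_rpow_div (ENNReal.ofReal (p - 1))
  have hp := h.lt
  rw [ENNReal.toReal_ofReal (by linarith), ← ENNReal.ofReal_div_of_pos (by linarith),
    ← h.conjugate_eq] at h1
  refine h1.of_le (aestronglyMeasurable_abs_rpow_mul hU.1) (ae_of_all _ fun x => ?_)
  rw [Real.norm_eq_abs, Real.norm_eq_abs, abs_abs_rpow_mul hp, Real.norm_eq_abs,
    abs_of_nonneg (Real.rpow_nonneg (abs_nonneg _) _)]

theorem integrable_abs_rpow_mul_mul {p : ℝ} (hp : 1 < p) {U H : α → ℝ}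
    (hU : MemLp U (ENNReal.ofReal p) μ) (hH : MemLp H (ENNReal.ofReal p) μ) :
    Integrable (fun x => |U x| ^ (p - 2) * U x * H x) μ := by
  have hc := Real.HolderConjugate.conjExponent hp
  have := holderTriple_ofReal hc.symm
  exact (memLp_abs_rpow_mul hc hU).integrable_mul hH

/-- Differentiation under the integral: for `|t| < 1` the derivative is dominated by `p (|U| +
|H|)^{p-1} |H|`, integrable by Hölder. -/
theorem hasDerivAt_integral_abs_rpow {p : ℝ} (hp : 1 < p) {U H : α → ℝ}
    (hU : MemLp U (ENNReal.ofReal p) μ) (hH : MemLp H (ENNReal.ofReal p) μ) :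
    HasDerivAt (fun t : ℝ => ∫ x, |U x + t * H x| ^ p ∂μ)
      (p * ∫ x, |U x| ^ (p - 2) * U x * H x ∂μ) 0 := by
  have hB : MemLp (fun x => |U x| + |H x|) (ENNReal.ofReal p) μ := hU.abs.add hH.abs
  have hbound : Integrable
      (fun x => p * (|(|U x| + |H x|)| ^ (p - 2) * (|U x| + |H x|) * |H x|)) μ :=
    (integrable_abs_rpow_mul_mul hp hB hH.abs).const_mul p
  have hmem : ∀ t : ℝ, MemLp (fun x => U x + t * H x) (ENNReal.ofReal p) μ :=
    fun t => hU.add (hH.const_mul t)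
  have key := (hasDerivAt_integral_of_dominated_loc_of_deriv_le (μ := μ) (x₀ := (0 : ℝ))
    (s := Metric.ball 0 1) (F := fun t x => |U x + t * H x| ^ p)
    (F' := fun t x => p * |U x + t * H x| ^ (p - 2) * (U x + t * H x) * H x)
    (Metric.ball_mem_nhds 0 one_pos)
    (Eventually.of_forall fun t => (integrable_abs_rpow hp (hmem t)).1)
    (integrable_abs_rpow hp (hmem 0)) ?_ ?_ hbound ?_).2
  · refine key.congr_deriv ?_
    rw [← integral_const_mul]
    refine integral_congr_ae (ae_of_all _ fun x => ?_)
    simp only [zero_mul, add_zero]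
    ring
  · have h := (integrable_abs_rpow_mul_mul hp (hmem 0) hH).const_mul p
    refine h.1.congr (ae_of_all _ fun x => ?_)
    simp only
    ring
  · refine ae_of_all _ fun x t ht => ?_
    have ht1 : |t| ≤ 1 := by
      rw [mem_ball_zero_iff] at ht
      exact ht.le
    have h1 : |U x + t * H x| ≤ |U x| + |H x| := by
      refine (abs_add_le _ _).trans ?_
      rw [abs_mul]
      nlinarith [abs_nonneg (H x)]
    have h2 : |(|U x| + |H x|)| ^ (p - 2) * (|U x| + |H x|) = |(|U x| + |H x|)| ^ (p - 1) := 
      (abs_of_nonneg (mul_nonneg (Real.rpow_nonneg (abs_nonneg _) _) (by positivity))).symm.trans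
        (abs_abs_rpow_mul hp _)
    rw [h2, mul_assoc p, mul_assoc p, Real.norm_eq_abs, abs_mul, abs_mul, abs_abs_rpow_mul hp,
      abs_of_pos (by linarith : 0 < p), abs_of_nonneg (by positivity : 0 ≤ |U x| + |H x|)]
    gcongr
  · refine ae_of_all _ fun x t _ => ?_
    have h1 : HasDerivAt (fun t : ℝ => U x + t * H x) (H x) t := by
      simpa using ((hasDerivAt_id t).mul_const (H x)).const_add (U x)
    exact (hasDerivAt_abs_rpow (U x + t * H x) hp).comp t h1

/-- On a closed subspace of `L^p` every bounded linear functional is represented by an element of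
that subspace through the duality map `U ↦ |U|^{p-2} U`. -/
theorem exists_duality_representative {p : ℝ} (hp : 1 < p) [Fact (1 ≤ ENNReal.ofReal p)]
    (V : Submodule ℝ (Lp ℝ (ENNReal.ofReal p) μ)) 
    (hV : IsClosed (V : Set (Lp ℝ (ENNReal.ofReal p) μ)))
    (L : Lp ℝ (ENNReal.ofReal p) μ →L[ℝ] ℝ) :
    ∃ U ∈ V, ∀ H ∈ V, ∫ x, |U x| ^ (p - 2) * U x * H x ∂μ = L H := by
  have hp0 : 0 < p := by linarith
  -- The desired identity is the Euler–Lagrange equation of this energy on `V`.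
  let F : Lp ℝ (ENNReal.ofReal p) μ → ℝ := fun U => ‖U‖ ^ p / p - L U
  have hFc : Continuous F :=
    ((continuous_norm.rpow_const fun _ => Or.inr hp0.le).div_const p).sub L.continuous
  obtain ⟨B, hB⟩ := exists_sub_le_rpow_div_sub hp (norm_nonneg L)
  have hcoer : ∀ U, ‖U‖ - B ≤ F U := by
    intro U
    have h1 := hB ‖U‖ (norm_nonneg U)
    have h2 : L U ≤ ‖L‖ * ‖U‖ := (le_abs_self _).trans (L.le_opNorm U)
    simp only [F]
    linarith
  have hbdd : BddBelow (F '' V) := by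
    refine ⟨-B, ?_⟩
    rintro _ ⟨U, -, rfl⟩
    linarith [hcoer U, norm_nonneg U]
  have hne : (F '' V).Nonempty := ⟨F 0, 0, V.zero_mem, rfl⟩
  set m := sInf (F '' V) with hm
  have hmle : ∀ U ∈ V, m ≤ F U := fun U hU => csInf_le hbdd ⟨U, hU, rfl⟩
  have hseq : ∀ n : ℕ, ∃ U ∈ V, F U < m + 1 / ((n : ℝ) + 1) := by
    intro n
    have hpos : 0 < 1 / ((n : ℝ) + 1) := by positivity
    obtain ⟨_, ⟨U, hU, rfl⟩, hlt⟩ := exists_lt_of_csInf_lt hne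
      (lt_add_of_pos_right m hpos)
    exact ⟨U, hU, hlt⟩
  choose u huV hu using hseq
  have hubd : ∀ n, ‖u n‖ ≤ m + 1 + B := by
    intro n
    have h1 := hcoer (u n)
    have h2 := hu n
    have h3 : 1 / ((n : ℝ) + 1) ≤ 1 := by
      rw [div_le_one (by positivity)]
      linarith [(Nat.cast_nonneg n : (0 : ℝ) ≤ n)]
    linarith
  set R := m + 1 + B with hR
  have hR0 : 0 ≤ R := (norm_nonneg _).trans (hubd 0)
  -- Uniform convexity of the norm, obtained by integrating the scalar inequality.
  have hconv : ∀ ε : ℝ, 0 < ε → ∃ C : ℝ, 0 ≤ C ∧ ∀ U W : Lp ℝ (ENNReal.ofReal p) μ,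
      ‖U - W‖ ^ p ≤ ε * (‖U‖ ^ p + ‖W‖ ^ p) +
        C * ((‖U‖ ^ p + ‖W‖ ^ p) / 2 - ‖(2⁻¹ : ℝ) • (U + W)‖ ^ p) := by
    intro ε hε
    obtain ⟨C, hC, hle⟩ := exists_abs_sub_rpow_le hp hε
    refine ⟨C, hC, fun U W => ?_⟩
    have hiU := integrable_abs_rpow hp (Lp.memLp U)
    have hiW := integrable_abs_rpow hp (Lp.memLp W)
    have hiD := integrable_abs_rpow hp (Lp.memLp (U - W))
    have hiM := integrable_abs_rpow hp (Lp.memLp ((2⁻¹ : ℝ) • (U + W)))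
    have hiS : Integrable (fun x => |U x| ^ p + |W x| ^ p) μ := hiU.add hiW
    have hiG : Integrable (fun x => (|U x| ^ p + |W x| ^ p) / 2 -
        |((2⁻¹ : ℝ) • (U + W) : Lp ℝ (ENNReal.ofReal p) μ) x| ^ p) μ := (hiS.div_const 2).sub hiM
    rw [Lp_norm_rpow_eq_integral hp, Lp_norm_rpow_eq_integral hp, Lp_norm_rpow_eq_integral hp,
      Lp_norm_rpow_eq_integral hp, ← integral_add hiU hiW, ← integral_div,
      ← integral_sub (hiS.div_const 2) hiM, ← integral_const_mul, ← integral_const_mul,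
      ← integral_add (hiS.const_mul ε) (hiG.const_mul C)]
    refine integral_mono_ae hiD ((hiS.const_mul ε).add (hiG.const_mul C)) ?_
    filter_upwards [Lp.coeFn_sub U W, Lp.coeFn_smul (2⁻¹ : ℝ) (U + W), Lp.coeFn_add U W]
      with x h1 h2 h3
    simp only [h1, h2, h3, Pi.sub_apply, Pi.smul_apply, Pi.add_apply, smul_eq_mul]
    rw [show 2⁻¹ * (U x + W x) = (U x + W x) / 2 by ring]
    exact hle (U x) (W x)
  -- The midpoint lies in `V`, so its energy is at least `m`; the linear terms cancel and only the
  -- convexity gap remains.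
  have hgap : ∀ n k, (‖u n‖ ^ p + ‖u k‖ ^ p) / 2 - ‖(2⁻¹ : ℝ) • (u n + u k)‖ ^ p ≤
      p * (1 / ((n : ℝ) + 1) + 1 / ((k : ℝ) + 1)) := by
    intro n k
    have h1 := hmle _ (V.smul_mem (2⁻¹ : ℝ) (V.add_mem (huV n) (huV k)))
    have h2 := hu n
    have h3 := hu k
    simp only [F, map_smul, map_add, smul_eq_mul] at h1 h2 h3
    have h4 : 0 < 1 / ((n : ℝ) + 1) := by positivity
    have h5 : 0 < 1 / ((k : ℝ) + 1) := by positivity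
    have h6 : ((‖u n‖ ^ p + ‖u k‖ ^ p) / 2 - ‖(2⁻¹ : ℝ) • (u n + u k)‖ ^ p) / p ≤
        1 / ((n : ℝ) + 1) + 1 / ((k : ℝ) + 1) := by
      have : ((‖u n‖ ^ p + ‖u k‖ ^ p) / 2 - ‖(2⁻¹ : ℝ) • (u n + u k)‖ ^ p) / p =
        (‖u n‖ ^ p / p + ‖u k‖ ^ p / p) / 2 - ‖(2⁻¹ : ℝ) • (u n + u k)‖ ^ p / p := by ring
      linarith
    rw [div_le_iff₀ hp0] at h6
    linarith
  have hcauchy : CauchySeq u := by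
    rw [Metric.cauchySeq_iff]
    intro η hη
    have hηp : 0 < η ^ p := by positivity
    -- The two terms of `hconv` are each to be at most `η^p / 2`: this `ε` handles the first through
    -- `‖u j‖ ≤ R`, and `n₀` below handles the second through `hgap`. The added `1`s keep the
    -- denominators positive.
    obtain ⟨C, hC, hle⟩ := hconv (η ^ p / (4 * (R ^ p + 1))) (by positivity)
    obtain ⟨n₀, hn₀⟩ := exists_nat_one_div_lt
      (show 0 < η ^ p / (4 * (C * p + 1)) by positivity)
    refine ⟨n₀, fun n hn k hk => ?_⟩
    rw [dist_eq_norm]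
    have hmono : ∀ j : ℕ, n₀ ≤ j → 1 / ((j : ℝ) + 1) < η ^ p / (4 * (C * p + 1)) := by
      intro j hj
      refine lt_of_le_of_lt ?_ hn₀
      gcongr
    have h1 := hle (u n) (u k)
    have h2 := hgap n k
    have h3 : ∀ j, ‖u j‖ ^ p ≤ R ^ p := fun j => Real.rpow_le_rpow (norm_nonneg _) (hubd j) hp0.le
    have h4 : η ^ p / (4 * (R ^ p + 1)) * (‖u n‖ ^ p + ‖u k‖ ^ p) ≤ η ^ p / 2 := by
      calc _ ≤ η ^ p / (4 * (R ^ p + 1)) * (2 * (R ^ p + 1)) := by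
            gcongr
            linarith [h3 n, h3 k]
        _ = η ^ p / 2 := by field_simp; ring
    have h5 : C * ((‖u n‖ ^ p + ‖u k‖ ^ p) / 2 - ‖(2⁻¹ : ℝ) • (u n + u k)‖ ^ p) < η ^ p / 2 := by
      have hd : 0 < η ^ p / (4 * (C * p + 1)) := by positivity
      calc _ ≤ C * (p * (1 / ((n : ℝ) + 1) + 1 / ((k : ℝ) + 1))) := by gcongr
        _ ≤ C * (p * (η ^ p / (4 * (C * p + 1)) + η ^ p / (4 * (C * p + 1)))) := by
            have h6 := add_le_add (hmono n hn).le (hmono k hk).le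
            exact mul_le_mul_of_nonneg_left (mul_le_mul_of_nonneg_left h6 hp0.le) hC
        _ = 2 * (C * p) * (η ^ p / (4 * (C * p + 1))) := by ring
        _ < 2 * (C * p + 1) * (η ^ p / (4 * (C * p + 1))) := by
            gcongr
            linarith
        _ = η ^ p / 2 := by field_simp; ring
    exact lt_of_not_ge fun hge =>
      absurd (Real.rpow_le_rpow hη.le hge hp0.le) (by linarith)
  obtain ⟨U, hU⟩ := cauchySeq_tendsto_of_complete hcauchy
  have hUV : U ∈ V := hV.mem_of_tendsto hU (Eventually.of_forall huV)
  have hUmin : F U ≤ m := by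
    have h1 : Tendsto (fun n => F (u n)) atTop (𝓝 (F U)) := (hFc.tendsto U).comp hU
    have h2 : Tendsto (fun n : ℕ => m + 1 / ((n : ℝ) + 1)) atTop (𝓝 (m + 0)) :=
      tendsto_one_div_add_atTop_nhds_zero_nat.const_add m
    rw [add_zero] at h2
    exact le_of_tendsto_of_tendsto' h1 h2 fun n => (hu n).le
  refine ⟨U, hUV, fun H hH => ?_⟩
  have hd := ((hasDerivAt_integral_abs_rpow hp (Lp.memLp U) (Lp.memLp H)).div_const p).sub
    ((hasDerivAt_id (0 : ℝ)).mul_const (L H) |>.const_add (L U))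
  have hF : ∀ t : ℝ, (∫ x, |U x + t * H x| ^ p ∂μ) / p - (L U + t * L H) = F (U + t • H) := by
    intro t
    simp only [F, map_add, map_smul, smul_eq_mul]
    rw [Lp_norm_rpow_eq_integral hp]
    congr 2
    refine integral_congr_ae ?_
    filter_upwards [Lp.coeFn_add U (t • H), Lp.coeFn_smul t H] with x h1 h2
    rw [h1, Pi.add_apply, h2, Pi.smul_apply, smul_eq_mul]
  -- The line `t ↦ U + t • H` stays in `V`, so its energy is minimal at `t = 0`.
  have hmin : IsLocalMin
      ((fun t : ℝ => (∫ x, |U x + t * H x| ^ p ∂μ) / p) - fun t => L U + id t * L H) 0 := by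
    refine Eventually.of_forall fun t => ?_
    simp only [Pi.sub_apply, id]
    rw [hF, hF, zero_smul, add_zero]
    exact hUmin.trans (hmle _ (V.add_mem hUV (V.smul_mem t hH)))
  have := hmin.hasDerivAt_eq_zero hd
  rw [mul_div_cancel_left₀ _ hp0.ne'] at this
  linarith

end Minimization

/-! ### Weighted difference quotients and the closedness of their range -/

section DifferenceQuotient

variable {N : ℕ}

/-- The weighted difference quotient `(u(x) - u(y)) / |x - y|^a`. -/
noncomputable def diffQuot (a : ℝ) (u : EuclideanSpace ℝ (Fin N) → ℝ)
    (z : EuclideanSpace ℝ (Fin N) × EuclideanSpace ℝ (Fin N)) : ℝ :=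
  (u z.1 - u z.2) / ‖z.1 - z.2‖ ^ a

/-- On the diagonal both sides vanish, as `0 ^ a = 0` for `a ≠ 0`; the identity therefore holds at
every point. -/
theorem diffQuot_mul {a : ℝ} (ha : a ≠ 0) (u : EuclideanSpace ℝ (Fin N) → ℝ)
    (z : EuclideanSpace ℝ (Fin N) × EuclideanSpace ℝ (Fin N)) :
    diffQuot a u z * ‖z.1 - z.2‖ ^ a = u z.1 - u z.2 := by
  rcases eq_or_ne z.1 z.2 with h | h
  · simp [diffQuot, h, Real.zero_rpow ha]
  · have : ‖z.1 - z.2‖ ^ a ≠ 0 :=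
      (Real.rpow_pos_of_pos (norm_pos_iff.2 (sub_ne_zero.2 h)) a).ne'
    exact div_mul_cancel₀ _ this

theorem diffQuot_add (a : ℝ) (u v : EuclideanSpace ℝ (Fin N) → ℝ) :
    diffQuot a (u + v) = diffQuot a u + diffQuot a v := by
  ext z; simp only [diffQuot, Pi.add_apply]; ring

theorem diffQuot_sub (a : ℝ) (u v : EuclideanSpace ℝ (Fin N) → ℝ) :
    diffQuot a (u - v) = diffQuot a u - diffQuot a v := by
  ext z; simp only [diffQuot, Pi.sub_apply]; ring

theorem diffQuot_smul (a c : ℝ) (u : EuclideanSpace ℝ (Fin N) → ℝ) :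
    diffQuot a (c • u) = c • diffQuot a u := by
  ext z; simp only [diffQuot, Pi.smul_apply, smul_eq_mul]; ring

theorem diffQuot_const (a c : ℝ) :
    diffQuot a (fun _ : EuclideanSpace ℝ (Fin N) => c) = 0 := by
  ext z; simp [diffQuot]

theorem enorm_diffQuot_rpow {b p : ℝ} (hp : 0 < p) (hb : 0 < b)
    (u : EuclideanSpace ℝ (Fin N) → ℝ)
    (z : EuclideanSpace ℝ (Fin N) × EuclideanSpace ℝ (Fin N)) :
    ‖diffQuot (b / p) u z‖ₑ ^ p = ‖u z.1 - u z.2‖ₑ ^ p / ‖z.1 - z.2‖ₑ ^ b := by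
  rcases eq_or_ne z.1 z.2 with h | h
  -- On the diagonal the right side is `0 / 0`, which is `0` in `ENNReal`.
  · simp [diffQuot, h, ENNReal.zero_rpow_of_pos hp, ENNReal.zero_rpow_of_pos hb]
  · have hpos : 0 < ‖z.1 - z.2‖ := norm_pos_iff.2 (sub_ne_zero.2 h)
    rw [diffQuot, ← ofReal_norm, ← ofReal_norm, ← ofReal_norm,
      ENNReal.ofReal_rpow_of_nonneg (norm_nonneg _) hp.le,
      ENNReal.ofReal_rpow_of_nonneg (norm_nonneg _) hp.le,
      ENNReal.ofReal_rpow_of_nonneg (norm_nonneg _) hb.le,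
      ← ENNReal.ofReal_div_of_pos (Real.rpow_pos_of_pos hpos b), norm_div,
      Real.div_rpow (norm_nonneg _) (norm_nonneg _),
      Real.norm_of_nonneg (Real.rpow_nonneg hpos.le _), ← Real.rpow_mul hpos.le,
      div_mul_cancel₀ _ hp.ne']

/-- The kernel exponent `b = N + s * p` splits as `(b/p)(p - 2) + b/p + b/p`, one share for each
factor. -/
theorem weakIntegrand_eq {s p : ℝ} (hp : p ≠ 0) (u v : EuclideanSpace ℝ (Fin N) → ℝ)
    (z : EuclideanSpace ℝ (Fin N) × EuclideanSpace ℝ (Fin N)) :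
    weakIntegrand s p u v z = |diffQuot ((N + s * p) / p) u z| ^ (p - 2) *
      diffQuot ((N + s * p) / p) u z * diffQuot ((N + s * p) / p) v z := by
  rcases eq_or_ne z.1 z.2 with h | h
  · simp [weakIntegrand, diffQuot, h]
  · have hpos : 0 < ‖z.1 - z.2‖ := norm_pos_iff.2 (sub_ne_zero.2 h)
    simp only [weakIntegrand, diffQuot]
    generalize ‖z.1 - z.2‖ = r at hpos ⊢
    have h1 : r ^ ((N : ℝ) + s * p) =
        (r ^ (((N : ℝ) + s * p) / p)) ^ (p - 2) * r ^ (((N : ℝ) + s * p) / p) *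
          r ^ (((N : ℝ) + s * p) / p) := by
      rw [← Real.rpow_mul hpos.le, ← Real.rpow_add hpos, ← Real.rpow_add hpos]
      congr 1
      field_simp
      ring
    have h2 : 0 < r ^ (((N : ℝ) + s * p) / p) := Real.rpow_pos_of_pos hpos _
    rw [h1, abs_div, abs_of_pos h2, Real.div_rpow (abs_nonneg _) h2.le]
    generalize r ^ (((N : ℝ) + s * p) / p) = t at h2
    have h3 : 0 < t ^ (p - 2) := Real.rpow_pos_of_pos h2 _
    field_simp

theorem aestronglyMeasurable_diffQuot (a : ℝ) {u : EuclideanSpace ℝ (Fin N) → ℝ}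
    (hu : AEMeasurable u) : AEStronglyMeasurable (diffQuot a u) := by
  have h1 : AEMeasurable (fun z : EuclideanSpace ℝ (Fin N) × EuclideanSpace ℝ (Fin N) => u z.1) :=
    hu.comp_fst
  have h2 : AEMeasurable (fun z : EuclideanSpace ℝ (Fin N) × EuclideanSpace ℝ (Fin N) => u z.2) :=
    hu.comp_snd
  have h3 : Measurable (fun z : EuclideanSpace ℝ (Fin N) × EuclideanSpace ℝ (Fin N) =>
      ‖z.1 - z.2‖ ^ a) := (measurable_fst.sub measurable_snd).norm.pow_const a
  exact ((h1.sub h2).div h3.aemeasurable).aestronglyMeasurable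

theorem aestronglyMeasurable_diffQuot_slice (a : ℝ) {u : EuclideanSpace ℝ (Fin N) → ℝ}
    (hu : AEMeasurable u) (x : EuclideanSpace ℝ (Fin N)) :
    AEStronglyMeasurable (fun y => diffQuot a u (x, y)) := by
  have h3 : Measurable (fun y : EuclideanSpace ℝ (Fin N) => ‖x - y‖ ^ a) :=
    (measurable_const.sub measurable_id).norm.pow_const a
  exact (((aemeasurable_const (b := u x)).sub hu).div h3.aemeasurable).aestronglyMeasurable

variable {Ω : Set (EuclideanSpace ℝ (Fin N))}

theorem prod_univ_subset_Q : Ω ×ˢ (Set.univ : Set (EuclideanSpace ℝ (Fin N))) ⊆ Q Ω :=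
  fun _ hz hc => hc.1 hz.1

theorem restrict_prod_univ :
    (volume : Measure (EuclideanSpace ℝ (Fin N) × EuclideanSpace ℝ (Fin N))).restrict
      (Ω ×ˢ Set.univ) = (volume.restrict Ω).prod volume := by
  rw [Measure.volume_eq_prod, ← Measure.prod_restrict, Measure.restrict_univ]

theorem prod_le_restrict_Q :
    (volume.restrict Ω).prod volume ≤
      (volume : Measure (EuclideanSpace ℝ (Fin N) × EuclideanSpace ℝ (Fin N))).restrict (Q Ω) := by
  rw [← restrict_prod_univ]
  exact Measure.restrict_mono prod_univ_subset_Q le_rfl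

theorem ae_restrict_neBot (hΩ : IsOpen Ω) (hne : Ω.Nonempty) :
    (ae (volume.restrict Ω)).NeBot := by
  rw [ae_neBot, Ne, Measure.restrict_eq_zero]
  exact hΩ.measure_ne_zero volume hne

/-- A property that holds almost everywhere in `Q(Ω)` holds almost everywhere along some slice. -/
theorem exists_ae_slice (hΩ : IsOpen Ω) (hne : Ω.Nonempty)
    {P : EuclideanSpace ℝ (Fin N) × EuclideanSpace ℝ (Fin N) → Prop}
    (h : ∀ᵐ z ∂volume.restrict (Q Ω), P z) : ∃ x, ∀ᵐ y, P (x, y) := by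
  have := ae_restrict_neBot hΩ hne
  have h' : ∀ᵐ z ∂(volume.restrict Ω).prod volume, P z := ae_mono prod_le_restrict_Q h
  exact (Measure.ae_ae_of_ae_prod h').exists

/-- One good slice compares almost every value `d y` with the single number `d x`. -/
theorem ae_eq_const_of_diffQuot (hΩ : IsOpen Ω) (hne : Ω.Nonempty) {a : ℝ} (ha : a ≠ 0)
    {d : EuclideanSpace ℝ (Fin N) → ℝ} (h : diffQuot a d =ᵐ[volume.restrict (Q Ω)] 0) :
    ∃ c, ∀ᵐ y, d y = c := by
  obtain ⟨x, hx⟩ := exists_ae_slice hΩ hne h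
  refine ⟨d x, ?_⟩
  filter_upwards [hx] with y hy
  have := diffQuot_mul ha d (x, y)
  rw [hy, Pi.zero_apply, zero_mul] at this
  linarith

/-- A function with `p`-integrable difference quotients on `Q(Ω)` is locally in `L^p`. -/
theorem memLp_restrict_of_diffQuot (hΩ : IsOpen Ω) (hne : Ω.Nonempty) {a p : ℝ} (ha : 0 < a)
    (hp : 0 < p) {u : EuclideanSpace ℝ (Fin N) → ℝ} (hu : AEMeasurable u)
    (hq : MemLp (diffQuot a u) (ENNReal.ofReal p) (volume.restrict (Q Ω)))
    {B : Set (EuclideanSpace ℝ (Fin N))} (hB : MeasurableSet B) (hBb : Bornology.IsBounded B) :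
    MemLp u (ENNReal.ofReal p) (volume.restrict B) := by
  have := ae_restrict_neBot hΩ hne
  have hp0 : ENNReal.ofReal p ≠ 0 := by simpa using hp
  have h1 := (hq.mono_measure prod_le_restrict_Q).integrable_norm_rpow hp0 ENNReal.ofReal_ne_top
  -- For this `x`, `|u x - u y| ≤ R^a |diffQuot a u (x, y)|` whenever `|x - y| ≤ R`, which bounds
  -- `u` in `L^p(B)` up to the constant `u x`.
  obtain ⟨x, hx⟩ := h1.prod_right_ae.exists
  have h2 : MemLp (fun y => diffQuot a u (x, y)) (ENNReal.ofReal p) :=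
    (integrable_norm_rpow_iff (aestronglyMeasurable_diffQuot_slice a hu x) hp0
      ENNReal.ofReal_ne_top).1 hx
  obtain ⟨R, hR⟩ := hBb.subset_closedBall x
  have hfin : IsFiniteMeasure (volume.restrict B) :=
    ⟨by simpa using hBb.measure_lt_top⟩
  have h3 : MemLp (fun y => u x - u y) (ENNReal.ofReal p) (volume.restrict B) := by
    refine ((h2.restrict B).const_mul (R ^ a)).of_le
      (aemeasurable_const.sub hu.restrict).aestronglyMeasurable ?_
    refine (ae_restrict_iff' hB).2 (ae_of_all _ fun y hy => ?_)
    have hy' : ‖x - y‖ ≤ R := by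
      simpa [dist_eq_norm, norm_sub_rev] using hR hy
    have h4 := diffQuot_mul ha.ne' u (x, y)
    simp only at h4
    rw [← h4, norm_mul, norm_mul, mul_comm, Real.norm_of_nonneg (by positivity : 0 ≤ ‖x - y‖ ^ a),
      Real.norm_of_nonneg (Real.rpow_nonneg ((norm_nonneg _).trans hy') a)]
    gcongr
  have h5 := (memLp_const (u x)).sub h3
  refine h5.ae_eq (ae_of_all _ fun y => ?_)
  simp

/-- The subspace of `L^p(Q(Ω))` formed by the difference quotients. -/
noncomputable def diffQuotRange (Ω : Set (EuclideanSpace ℝ (Fin N))) (a p : ℝ) :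
    Submodule ℝ (Lp ℝ (ENNReal.ofReal p)
      ((volume : Measure (EuclideanSpace ℝ (Fin N) × EuclideanSpace ℝ (Fin N))).restrict
        (Q Ω))) where
  carrier := {U | ∃ u : EuclideanSpace ℝ (Fin N) → ℝ, AEMeasurable u ∧
    U =ᵐ[volume.restrict (Q Ω)] diffQuot a u}
  zero_mem' := ⟨fun _ => 0, aemeasurable_const, by
    rw [diffQuot_const]
    exact Lp.coeFn_zero _ _ _⟩
  add_mem' := by
    rintro U W ⟨u, hu, hU⟩ ⟨w, hw, hW⟩
    refine ⟨u + w, hu.add hw, ?_⟩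
    rw [diffQuot_add]
    exact (Lp.coeFn_add U W).trans (hU.add hW)
  smul_mem' := by
    rintro c U ⟨u, hu, hU⟩
    refine ⟨c • u, hu.const_smul c, ?_⟩
    rw [diffQuot_smul]
    exact (Lp.coeFn_smul c U).trans (hU.const_smul c)

/-- Difference quotients determine functions only up to constants, so the representatives need not
converge. Subtracting their values at one good point `x` makes them converge almost everywhere,
along a subsequence. -/
theorem isClosed_diffQuotRange (hΩ : IsOpen Ω) (hne : Ω.Nonempty) {a p : ℝ} (ha : 0 < a)
    [Fact (1 ≤ ENNReal.ofReal p)] :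
    IsClosed (diffQuotRange Ω a p : Set (Lp ℝ (ENNReal.ofReal p)
      ((volume : Measure (EuclideanSpace ℝ (Fin N) × EuclideanSpace ℝ (Fin N))).restrict
        (Q Ω)))) := by
  refine IsSeqClosed.isClosed fun U W hU hUW => ?_
  choose u hu hquot using hU
  obtain ⟨φ, -, hφ⟩ := (tendstoInMeasure_of_tendsto_Lp hUW).exists_seq_tendsto_ae
  have hlim : ∀ᵐ z ∂volume.restrict (Q Ω),
      Tendsto (fun n => diffQuot a (u (φ n)) z) atTop (𝓝 (W z)) := by
    filter_upwards [hφ, ae_all_iff.2 hquot] with z h1 h2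
    exact h1.congr fun n => h2 (φ n)
  obtain ⟨x, hx⟩ := exists_ae_slice hΩ hne hlim
  let v : ℕ → EuclideanSpace ℝ (Fin N) → ℝ := fun n y => u (φ n) y - u (φ n) x
  -- The limit of `u (φ n) y - u (φ n) x`, read off from the slice of `W` at `x`.
  let w : EuclideanSpace ℝ (Fin N) → ℝ := fun y => -(W (x, y) * ‖x - y‖ ^ a)
  have hvw : ∀ᵐ y, Tendsto (fun n => v n y) atTop (𝓝 (w y)) := by
    filter_upwards [hx] with y hy
    refine ((hy.mul_const (‖x - y‖ ^ a)).neg).congr fun n => ?_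
    have := diffQuot_mul ha.ne' (u (φ n)) (x, y)
    simp only at this
    rw [this]
    simp [v]
  have hw : AEMeasurable w := aemeasurable_of_tendsto_metrizable_ae atTop
    (fun n => (hu (φ n)).sub_const _) hvw
  refine ⟨w, hw, ?_⟩
  have h1 : ∀ᵐ z : EuclideanSpace ℝ (Fin N) × EuclideanSpace ℝ (Fin N),
      Tendsto (fun n => v n z.1) atTop (𝓝 (w z.1)) :=
    Measure.quasiMeasurePreserving_fst.ae hvw
  have h2 : ∀ᵐ z : EuclideanSpace ℝ (Fin N) × EuclideanSpace ℝ (Fin N),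
      Tendsto (fun n => v n z.2) atTop (𝓝 (w z.2)) :=
    Measure.quasiMeasurePreserving_snd.ae hvw
  filter_upwards [hlim, ae_restrict_of_ae h1, ae_restrict_of_ae h2] with z hz hz1 hz2
  refine tendsto_nhds_unique hz (((hz1.sub hz2).div_const (‖z.1 - z.2‖ ^ a)).congr fun n => ?_)
  simp [v, diffQuot]

end DifferenceQuotient

/-! ### Description of the space `W` by difference quotients alone -/

section FunctionSpace

variable {N : ℕ} {Ω : Set (EuclideanSpace ℝ (Fin N))}

theorem lintegral_weight_lt_top {p : ℝ} (hp : 0 < p) {g u : EuclideanSpace ℝ (Fin N) → ℝ}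
    (hg : MemLp g ⊤ (volume.restrict Ωᶜ)) {K : Set (EuclideanSpace ℝ (Fin N))}
    (hK : MeasurableSet K) (hgK : ∀ᵐ x ∂(volume.restrict Ωᶜ), x ∉ K → g x = 0)
    (hu : MemLp u (ENNReal.ofReal p) (volume.restrict K)) :
    ∫⁻ x in Ωᶜ, ‖g x‖ₑ * ‖u x‖ₑ ^ p < ⊤ := by
  have hM : eLpNormEssSup g (volume.restrict Ωᶜ) < ⊤ := by
    simpa [eLpNorm_exponent_top] using hg.2
  have h1 : ∫⁻ x in K, ‖u x‖ₑ ^ p < ⊤ := by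
    simpa [ENNReal.toReal_ofReal hp.le] using lintegral_rpow_enorm_lt_top_of_eLpNorm_lt_top
      (by simpa using hp) ENNReal.ofReal_ne_top hu.2
  calc ∫⁻ x in Ωᶜ, ‖g x‖ₑ * ‖u x‖ₑ ^ p
      ≤ ∫⁻ x in Ωᶜ, K.indicator
          (fun x => eLpNormEssSup g (volume.restrict Ωᶜ) * ‖u x‖ₑ ^ p) x := by
        refine lintegral_mono_ae ?_
        filter_upwards [hgK, enorm_ae_le_eLpNormEssSup g (volume.restrict Ωᶜ)] with x h2 h3
        by_cases hx : x ∈ K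
        · rw [Set.indicator_of_mem hx]
          gcongr
        · simp [h2 hx]
    _ ≤ ∫⁻ x, K.indicator
          (fun x => eLpNormEssSup g (volume.restrict Ωᶜ) * ‖u x‖ₑ ^ p) x :=
        setLIntegral_le_lintegral _ _
    _ = eLpNormEssSup g (volume.restrict Ωᶜ) * ∫⁻ x in K, ‖u x‖ₑ ^ p := by
        rw [lintegral_indicator hK, lintegral_const_mul' _ _ hM.ne]
    _ < ⊤ := ENNReal.mul_lt_top hM h1

/-- The integrals of `|u|^p` over `Ω` and of `|g| |u|^p` outside are finite automatically: the
quotient term gives `u ∈ L^p` on bounded sets, `Ω` is bounded, and `g` is bounded and vanishes off a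
compact set. -/
theorem mem_SpaceW_iff (hΩ : IsOpen Ω) (hne : Ω.Nonempty) (hΩb : Bornology.IsBounded Ω)
    {s p : ℝ} (hp : 0 < p) (hsp : 0 < (N : ℝ) + s * p) {g : EuclideanSpace ℝ (Fin N) → ℝ}
    (hg : MemLp g ⊤ (volume.restrict Ωᶜ))
    (hgc : ∃ K : Set (EuclideanSpace ℝ (Fin N)), IsCompact K ∧
      ∀ᵐ x ∂(volume.restrict Ωᶜ), x ∉ K → g x = 0) {u : EuclideanSpace ℝ (Fin N) → ℝ} :
    u ∈ SpaceW Ω s p g ↔ AEMeasurable u ∧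
      MemLp (diffQuot ((N + s * p) / p) u) (ENNReal.ofReal p) (volume.restrict (Q Ω)) := by
  have hp0 : ENNReal.ofReal p ≠ 0 := by simpa using hp
  obtain ⟨K, hK, hgK⟩ := hgc
  refine and_congr_right fun hu => ?_
  have hquot : ∫⁻ z in Q Ω, ‖u z.1 - u z.2‖ₑ ^ p / ‖z.1 - z.2‖ₑ ^ ((N : ℝ) + s * p) =
      ∫⁻ z in Q Ω, ‖diffQuot ((N + s * p) / p) u z‖ₑ ^ p := by
    simp_rw [enorm_diffQuot_rpow hp hsp]
  have hLp : ∀ v : EuclideanSpace ℝ (Fin N) × EuclideanSpace ℝ (Fin N) → ℝ,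
      eLpNorm v (ENNReal.ofReal p) (volume.restrict (Q Ω)) < ⊤ ↔
        ∫⁻ z in Q Ω, ‖v z‖ₑ ^ p < ⊤ := fun v => by
    rw [eLpNorm_lt_top_iff_lintegral_rpow_enorm_lt_top hp0 ENNReal.ofReal_ne_top,
      ENNReal.toReal_ofReal hp.le]
  rw [eNormW, ENNReal.rpow_lt_top_iff_of_pos (by positivity), hquot]
  constructor
  · intro h
    refine ⟨(aestronglyMeasurable_diffQuot _ hu).restrict, (hLp _).2 ?_⟩
    exact lt_of_le_of_lt (le_add_self.trans le_self_add) h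
  · intro h
    have hloc : ∀ B : Set (EuclideanSpace ℝ (Fin N)), MeasurableSet B → Bornology.IsBounded B →
        MemLp u (ENNReal.ofReal p) (volume.restrict B) := fun B hB hBb =>
      memLp_restrict_of_diffQuot hΩ hne (div_pos hsp hp) hp hu h hB hBb
    refine ENNReal.add_lt_top.2 ⟨ENNReal.add_lt_top.2 ⟨?_, (hLp _).1 h.2⟩, ?_⟩
    · simpa [ENNReal.toReal_ofReal hp.le] using lintegral_rpow_enorm_lt_top_of_eLpNorm_lt_top
        hp0 ENNReal.ofReal_ne_top (hloc Ω hΩ.measurableSet hΩb).2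
    · exact lintegral_weight_lt_top hp hg hK.measurableSet hgK
        (hloc K hK.measurableSet hK.isBounded)

end FunctionSpace

/-! ### The data as one function, and its pairing through difference quotients -/

section Source

variable {N : ℕ} {Ω : Set (EuclideanSpace ℝ (Fin N))}

open Classical in
/-- The function equal to `f` in `Ω` and to `g` outside. -/
noncomputable def source (Ω : Set (EuclideanSpace ℝ (Fin N)))
    (f g : EuclideanSpace ℝ (Fin N) → ℝ) : EuclideanSpace ℝ (Fin N) → ℝ :=
  Ω.piecewise f g

theorem ae_source_eq_zero (hΩ : IsOpen Ω) {f g : EuclideanSpace ℝ (Fin N) → ℝ}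
    {K : Set (EuclideanSpace ℝ (Fin N))}
    (hgK : ∀ᵐ x ∂(volume.restrict Ωᶜ), x ∉ K → g x = 0) :
    ∀ᵐ x, x ∉ Ω ∪ K → source Ω f g x = 0 := by
  filter_upwards [(ae_restrict_iff' hΩ.measurableSet.compl).1 hgK] with x hx hxK
  rw [Set.mem_union, not_or] at hxK
  simp only [source, Set.piecewise, hxK.1, if_false]
  exact hx hxK.1 hxK.2

/-- A bounded `g` vanishing off a set of finite measure lies in every `L^q`. -/
theorem memLp_source (hΩ : IsOpen Ω) {q : ENNReal} {f g : EuclideanSpace ℝ (Fin N) → ℝ}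
    (hf : MemLp f q (volume.restrict Ω)) (hg : MemLp g ⊤ (volume.restrict Ωᶜ))
    {K : Set (EuclideanSpace ℝ (Fin N))} (hK : IsCompact K)
    (hgK : ∀ᵐ x ∂(volume.restrict Ωᶜ), x ∉ K → g x = 0) :
    MemLp (source Ω f g) q := by
  classical
  have hfin : IsFiniteMeasure ((volume.restrict Ωᶜ).restrict K) :=
    ⟨by
      rw [Measure.restrict_apply_univ]
      exact (Measure.restrict_apply_le _ _).trans_lt hK.measure_lt_top⟩
  have hg' : MemLp (K.indicator g) q (volume.restrict Ωᶜ) :=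
    (memLp_indicator_iff_restrict hK.measurableSet).2 ((hg.restrict K).mono_exponent le_top)
  have hg'' : MemLp g q (volume.restrict Ωᶜ) := by
    refine hg'.ae_eq ?_
    filter_upwards [hgK] with x hx
    by_cases hxK : x ∈ K
    · simp [hxK]
    · simp [hxK, hx hxK]
  have := hf.piecewise hΩ.measurableSet hg''
  exact this

theorem integral_source_mul (hΩ : IsOpen Ω) {f g v : EuclideanSpace ℝ (Fin N) → ℝ}
    (h : Integrable (fun x => source Ω f g x * v x)) :
    IntegrableOn (fun x => f x * v x) Ω ∧ IntegrableOn (fun x => g x * v x) Ωᶜ ∧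
      ∫ x, source Ω f g x * v x = (∫ x in Ω, f x * v x) + ∫ x in Ωᶜ, g x * v x := by
  have h1 : Set.EqOn (fun x => source Ω f g x * v x) (fun x => f x * v x) Ω := fun x hx => by
    simp [source, hx]
  have h2 : Set.EqOn (fun x => source Ω f g x * v x) (fun x => g x * v x) Ωᶜ := fun x hx => by
    have hx' : x ∉ Ω := hx
    simp [source, hx']
  refine ⟨h.integrableOn.congr_fun h1 hΩ.measurableSet,
    h.integrableOn.congr_fun h2 hΩ.measurableSet.compl, ?_⟩
  rw [← integral_add_compl hΩ.measurableSet h, setIntegral_congr_fun hΩ.measurableSet h1,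
    setIntegral_congr_fun hΩ.measurableSet.compl h2]

theorem integrable_mul_of_ae_eq_zero {p q : ℝ} (hpq : p.HolderConjugate q)
    {h u : EuclideanSpace ℝ (Fin N) → ℝ} (hh : MemLp h (ENNReal.ofReal q))
    {B : Set (EuclideanSpace ℝ (Fin N))} (hB : MeasurableSet B)
    (hhB : ∀ᵐ x, x ∉ B → h x = 0) (hu : MemLp u (ENNReal.ofReal p) (volume.restrict B)) :
    Integrable (fun x => h x * u x) := by
  have := holderTriple_ofReal hpq.symm
  have h1 : IntegrableOn (fun x => h x * u x) B := (hh.restrict B).integrable_mul hu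
  refine (integrable_indicator_iff hB).2 h1 |>.congr ?_
  filter_upwards [hhB] with x hx
  by_cases hxB : x ∈ B
  · simp [hxB]
  · simp [hxB, hx hxB]

/-- Pairing with a mean-zero function of bounded support factors through difference quotients. -/
theorem exists_diffQuot_representation (hΩ : IsOpen Ω) (hne : Ω.Nonempty)
    (hΩb : Bornology.IsBounded Ω) {a p q : ℝ} (ha : 0 < a) (hpq : p.HolderConjugate q)
    {h : EuclideanSpace ℝ (Fin N) → ℝ} (hh : MemLp h (ENNReal.ofReal q))
    {B : Set (EuclideanSpace ℝ (Fin N))} (hB : MeasurableSet B) (hBb : Bornology.IsBounded B)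
    (hhB : ∀ᵐ x, x ∉ B → h x = 0) (hzero : ∫ x, h x = 0) :
    ∃ G : EuclideanSpace ℝ (Fin N) × EuclideanSpace ℝ (Fin N) → ℝ,
      MemLp G (ENNReal.ofReal q) (volume.restrict (Q Ω)) ∧
      ∀ u : EuclideanSpace ℝ (Fin N) → ℝ, AEMeasurable u →
        MemLp (diffQuot a u) (ENNReal.ofReal p) (volume.restrict (Q Ω)) →
        ∫ z in Q Ω, G z * diffQuot a u z = ∫ x, h x * u x := by
  have hfin : IsFiniteMeasure (volume.restrict Ω) := ⟨by simpa using hΩb.measure_lt_top⟩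
  have hvol : (volume.restrict Ω).real Set.univ ≠ 0 := by
    rw [measureReal_restrict_apply_univ, measureReal_def, ENNReal.toReal_ne_zero]
    exact ⟨hΩ.measure_ne_zero volume hne, hΩb.measure_lt_top.ne⟩
  set m := (volume.restrict Ω).real Set.univ
  -- The weight cancels the denominator of the quotient, so the pairing is `-m⁻¹ ∫_Ω ∫ h(y)(u(x) -
  -- u(y)) dy dx`. This equals `∫ h u` minus the mean of `u` over `Ω` times `∫ h`, and the last
  -- integral is zero.
  let G₀ : EuclideanSpace ℝ (Fin N) × EuclideanSpace ℝ (Fin N) → ℝ :=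
    fun z => -m⁻¹ * (h z.2 * ‖z.1 - z.2‖ ^ a)
  have hset : MeasurableSet (Ω ×ˢ (Set.univ : Set (EuclideanSpace ℝ (Fin N)))) :=
    hΩ.measurableSet.prod MeasurableSet.univ
  have hG₀ : MemLp G₀ (ENNReal.ofReal q) ((volume.restrict Ω).prod volume) := by
    refine MemLp.const_mul ?_ _
    -- For `x ∈ Ω` and `y ∈ B` the growing weight `|x - y|^a` is at most `R^a`.
    obtain ⟨R, hR⟩ := (Metric.isBounded_iff.1 (hΩb.union hBb))
    have h1 : MemLp (fun z : EuclideanSpace ℝ (Fin N) × EuclideanSpace ℝ (Fin N) => h z.2)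
      (ENNReal.ofReal q) ((volume.restrict Ω).prod volume) := hh.comp_snd _
    have hmeas : Measurable (fun z : EuclideanSpace ℝ (Fin N) × EuclideanSpace ℝ (Fin N) =>
      ‖z.1 - z.2‖ ^ a) := (measurable_fst.sub measurable_snd).norm.pow_const a
    refine (h1.const_mul (R ^ a)).of_le (h1.1.mul hmeas.aestronglyMeasurable) ?_
    have h2 : ∀ᵐ z ∂(volume.restrict Ω).prod
        (volume : Measure (EuclideanSpace ℝ (Fin N))), z.2 ∉ B → h z.2 = 0 :=
      Measure.quasiMeasurePreserving_snd.ae hhB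
    have h3 : ∀ᵐ z ∂(volume.restrict Ω).prod
        (volume : Measure (EuclideanSpace ℝ (Fin N))), z.1 ∈ Ω :=
      Measure.quasiMeasurePreserving_fst.ae (ae_restrict_mem hΩ.measurableSet)
    filter_upwards [h2, h3] with z hz2 hz3
    by_cases hzB : z.2 ∈ B
    · have hd : ‖z.1 - z.2‖ ≤ R := by
        rw [← dist_eq_norm]
        exact hR (Or.inl hz3) (Or.inr hzB)
      rw [norm_mul, norm_mul, mul_comm, Real.norm_of_nonneg (by positivity : 0 ≤ ‖z.1 - z.2‖ ^ a),
        Real.norm_of_nonneg (Real.rpow_nonneg ((norm_nonneg _).trans hd) a)]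
      gcongr
    · simp [hz2 hzB]
  refine ⟨(Ω ×ˢ Set.univ).indicator G₀, MemLp.restrict _ ?_, fun u hu hq => ?_⟩
  · rw [memLp_indicator_iff_restrict hset, restrict_prod_univ]
    exact hG₀
  · have hp0 := hpq.pos
    have hloc : ∀ B : Set (EuclideanSpace ℝ (Fin N)), MeasurableSet B → Bornology.IsBounded B →
        MemLp u (ENNReal.ofReal p) (volume.restrict B) := fun B hB hBb =>
      memLp_restrict_of_diffQuot hΩ hne ha hp0 hu hq hB hBb
    have hone : 1 ≤ ENNReal.ofReal p := by
      rw [ENNReal.one_le_ofReal]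
      exact hpq.lt.le
    have hfinB : IsFiniteMeasure (volume.restrict B) := ⟨by simpa using hBb.measure_lt_top⟩
    have hhu : Integrable (fun x => h x * u x) :=
      integrable_mul_of_ae_eq_zero hpq hh hB hhB (hloc B hB hBb)
    have hhi : Integrable h := by
      simpa using integrable_mul_of_ae_eq_zero hpq hh hB hhB (memLp_const (1 : ℝ))
    have huΩ : Integrable u (volume.restrict Ω) :=
      (hloc Ω hΩ.measurableSet hΩb).integrable hone
    have hpt : ∀ z : EuclideanSpace ℝ (Fin N) × EuclideanSpace ℝ (Fin N),
        (Ω ×ˢ Set.univ).indicator G₀ z * diffQuot a u z =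
        (Ω ×ˢ Set.univ).indicator
          (fun z => m⁻¹ * (1 * (h z.2 * u z.2)) - m⁻¹ * (u z.1 * h z.2)) z := by
      intro z
      by_cases hz : z ∈ Ω ×ˢ (Set.univ : Set (EuclideanSpace ℝ (Fin N)))
      · rw [Set.indicator_of_mem hz, Set.indicator_of_mem hz]
        have := diffQuot_mul ha.ne' u z
        simp only [G₀]
        linear_combination (-m⁻¹ * h z.2) * this
      · rw [Set.indicator_of_notMem hz, Set.indicator_of_notMem hz, zero_mul]
    have hi1 : Integrable (fun z : EuclideanSpace ℝ (Fin N) × EuclideanSpace ℝ (Fin N) =>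
        (1 : ℝ) * (h z.2 * u z.2)) ((volume.restrict Ω).prod volume) :=
      (integrable_const (1 : ℝ)).mul_prod hhu
    have hi2 : Integrable (fun z : EuclideanSpace ℝ (Fin N) × EuclideanSpace ℝ (Fin N) =>
        u z.1 * h z.2) ((volume.restrict Ω).prod volume) := huΩ.mul_prod hhi
    simp_rw [hpt]
    rw [setIntegral_indicator hset, Set.inter_eq_right.2 prod_univ_subset_Q, restrict_prod_univ,
      integral_sub (hi1.const_mul _) (hi2.const_mul _), integral_const_mul m⁻¹,
      integral_const_mul m⁻¹,
      integral_prod_mul (fun _ => (1 : ℝ)) (fun y => h y * u y), integral_prod_mul u h, hzero,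
      integral_const, smul_eq_mul, mul_one, mul_zero, mul_zero, sub_zero, ← mul_assoc,
      inv_mul_cancel₀ hvol, one_mul]

end Source

/-! ### Existence and uniqueness for the weak formulation -/

section WeakSolution

variable {N : ℕ} {Ω : Set (EuclideanSpace ℝ (Fin N))}

/-- The weak formulation in terms of weighted difference quotients. -/
theorem isWeakSolution_iff (hΩ : IsOpen Ω) (hne : Ω.Nonempty) (hΩb : Bornology.IsBounded Ω)
    {s p q : ℝ} (hpq : p.HolderConjugate q) (hsp : 0 < (N : ℝ) + s * p)
    {f g : EuclideanSpace ℝ (Fin N) → ℝ} (hf : MemLp f (ENNReal.ofReal q) (volume.restrict Ω))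
    (hg : MemLp g ⊤ (volume.restrict Ωᶜ)) (hgc : ∃ K : Set (EuclideanSpace ℝ (Fin N)),
      IsCompact K ∧ ∀ᵐ x ∂(volume.restrict Ωᶜ), x ∉ K → g x = 0)
    {u : EuclideanSpace ℝ (Fin N) → ℝ} :
    IsWeakSolution Ω s p f g u ↔ (AEMeasurable u ∧
      MemLp (diffQuot ((N + s * p) / p) u) (ENNReal.ofReal p) (volume.restrict (Q Ω))) ∧
      ∀ v : EuclideanSpace ℝ (Fin N) → ℝ, AEMeasurable v →
        MemLp (diffQuot ((N + s * p) / p) v) (ENNReal.ofReal p) (volume.restrict (Q Ω)) →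
        (1 / 2 : ℝ) * ∫ z in Q Ω, |diffQuot ((N + s * p) / p) u z| ^ (p - 2) *
          diffQuot ((N + s * p) / p) u z * diffQuot ((N + s * p) / p) v z =
            ∫ x, source Ω f g x * v x := by
  have hW := fun v => mem_SpaceW_iff hΩ hne hΩb hpq.pos hsp hg hgc (u := v)
  obtain ⟨K, hK, hgK⟩ := hgc
  have hint : ∀ v : EuclideanSpace ℝ (Fin N) → ℝ, AEMeasurable v →
      MemLp (diffQuot ((N + s * p) / p) v) (ENNReal.ofReal p) (volume.restrict (Q Ω)) →
      Integrable (fun x => source Ω f g x * v x) := fun v hv hvq =>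
    integrable_mul_of_ae_eq_zero hpq (memLp_source hΩ hf hg hK hgK)
      (hΩ.measurableSet.union hK.measurableSet) (ae_source_eq_zero hΩ hgK)
      (memLp_restrict_of_diffQuot hΩ hne (div_pos hsp hpq.pos) hpq.pos hv hvq
        (hΩ.measurableSet.union hK.measurableSet) (hΩb.union hK.isBounded))
  rw [IsWeakSolution, hW]
  refine and_congr_right fun hu => ⟨fun h v hv hvq => ?_, fun h v hv => ?_⟩
  · have h1 := (h v ((hW v).2 ⟨hv, hvq⟩)).2.2.2
    simp_rw [weakIntegrand_eq hpq.pos.ne'] at h1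
    rw [h1, (integral_source_mul hΩ (hint v hv hvq)).2.2]
  · obtain ⟨hv, hvq⟩ := (hW v).1 hv
    obtain ⟨h1, h2, h3⟩ := integral_source_mul hΩ (hint v hv hvq)
    refine ⟨?_, h1, h2, ?_⟩
    · exact (integrable_abs_rpow_mul_mul hpq.lt hu.2 hvq).congr
        (ae_of_all _ fun z => (weakIntegrand_eq hpq.pos.ne' u v z).symm)
    · simp_rw [weakIntegrand_eq hpq.pos.ne']
      rw [← h3]
      exact h v hv hvq

theorem exists_weak_formulation (hΩ : IsOpen Ω) (hne : Ω.Nonempty)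
    (hΩb : Bornology.IsBounded Ω) {a p q : ℝ} (ha : 0 < a) (hpq : p.HolderConjugate q)
    {h : EuclideanSpace ℝ (Fin N) → ℝ} (hh : MemLp h (ENNReal.ofReal q))
    {B : Set (EuclideanSpace ℝ (Fin N))} (hB : MeasurableSet B) (hBb : Bornology.IsBounded B)
    (hhB : ∀ᵐ x, x ∉ B → h x = 0) (hzero : ∫ x, h x = 0) :
    ∃ u : EuclideanSpace ℝ (Fin N) → ℝ, (AEMeasurable u ∧
      MemLp (diffQuot a u) (ENNReal.ofReal p) (volume.restrict (Q Ω))) ∧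
      ∀ v : EuclideanSpace ℝ (Fin N) → ℝ, AEMeasurable v →
        MemLp (diffQuot a v) (ENNReal.ofReal p) (volume.restrict (Q Ω)) →
        (1 / 2 : ℝ) * ∫ z in Q Ω, |diffQuot a u z| ^ (p - 2) * diffQuot a u z * diffQuot a v z =
          ∫ x, h x * v x := by
  have hfact : Fact (1 ≤ ENNReal.ofReal p) := ⟨by
    rw [ENNReal.one_le_ofReal]
    exact hpq.lt.le⟩
  have hfact' : Fact (1 ≤ ENNReal.ofReal q) := ⟨by
    rw [ENNReal.one_le_ofReal]
    exact hpq.symm.lt.le⟩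
  have htriple : ENNReal.HolderConjugate (ENNReal.ofReal q) (ENNReal.ofReal p) :=
    holderTriple_ofReal hpq.symm
  obtain ⟨G, hG, hrep⟩ :=
    exists_diffQuot_representation hΩ hne hΩb ha hpq hh hB hBb hhB hzero
  let L : Lp ℝ (ENNReal.ofReal p) ((volume : Measure (EuclideanSpace ℝ (Fin N) ×
      EuclideanSpace ℝ (Fin N))).restrict (Q Ω)) →L[ℝ] ℝ :=
    -- The factor `2` compensates the `1 / 2` of the weak formulation.
    (2 : ℝ) • (ContinuousLinearMap.mul ℝ ℝ).lpPairing _ (ENNReal.ofReal q) (ENNReal.ofReal p)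
      (hG.toLp G)
  obtain ⟨U, ⟨u, hu, hUu⟩, hUL⟩ := exists_duality_representative hpq.lt (diffQuotRange Ω a p)
    (isClosed_diffQuotRange hΩ hne ha) L
  refine ⟨u, ⟨hu, (Lp.memLp U).ae_eq hUu⟩, fun v hv hvq => ?_⟩
  have h1 := hUL (hvq.toLp _) ⟨v, hv, hvq.coeFn_toLp⟩
  have h2 : ∫ z in Q Ω, |U z| ^ (p - 2) * U z * (hvq.toLp _) z =
      ∫ z in Q Ω, |diffQuot a u z| ^ (p - 2) * diffQuot a u z * diffQuot a v z := by
    refine integral_congr_ae ?_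
    filter_upwards [hUu, hvq.coeFn_toLp] with z h3 h4
    rw [h3, h4]
  have h3 : L (hvq.toLp _) = 2 * ∫ x, h x * v x := by
    rw [← hrep v hv hvq]
    simp only [L, _root_.smul_apply, smul_eq_mul,
      ContinuousLinearMap.lpPairing_eq_integral]
    congr 1
    refine integral_congr_ae ?_
    filter_upwards [hG.coeFn_toLp, hvq.coeFn_toLp] with z h3 h4
    rw [h3, h4, ContinuousLinearMap.mul_apply']
  rw [← h2, h1, h3]
  ring

theorem diffQuot_ae_eq_of_add_const (a : ℝ) {u w : EuclideanSpace ℝ (Fin N) → ℝ} {c : ℝ}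
    (h : ∀ᵐ x, w x = u x + c) : diffQuot a w =ᵐ[volume.restrict (Q Ω)] diffQuot a u := by
  have h1 : ∀ᵐ z : EuclideanSpace ℝ (Fin N) × EuclideanSpace ℝ (Fin N), w z.1 = u z.1 + c :=
    Measure.quasiMeasurePreserving_fst.ae h
  have h2 : ∀ᵐ z : EuclideanSpace ℝ (Fin N) × EuclideanSpace ℝ (Fin N), w z.2 = u z.2 + c :=
    Measure.quasiMeasurePreserving_snd.ae h
  filter_upwards [ae_restrict_of_ae h1, ae_restrict_of_ae h2] with z hz1 hz2
  simp [diffQuot, hz1, hz2]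

/-- Two functions whose difference quotients have the same image under the duality map, tested
against the difference quotient of their difference, differ by a constant. -/
theorem ae_eq_add_const_of_integral_eq (hΩ : IsOpen Ω) (hne : Ω.Nonempty) {a p : ℝ} (ha : a ≠ 0)
    (hp : 1 < p) {u w : EuclideanSpace ℝ (Fin N) → ℝ}
    (hu : MemLp (diffQuot a u) (ENNReal.ofReal p) (volume.restrict (Q Ω)))
    (hw : MemLp (diffQuot a w) (ENNReal.ofReal p) (volume.restrict (Q Ω)))
    (h : ∫ z in Q Ω, |diffQuot a w z| ^ (p - 2) * diffQuot a w z * diffQuot a (w - u) z =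
      ∫ z in Q Ω, |diffQuot a u z| ^ (p - 2) * diffQuot a u z * diffQuot a (w - u) z) :
    ∃ c : ℝ, ∀ᵐ x, w x = u x + c := by
  rw [diffQuot_sub] at h
  have hi := (integrable_abs_rpow_mul_mul hp hw (hw.sub hu)).sub
    (integrable_abs_rpow_mul_mul hp hu (hw.sub hu))
  have heq : ((fun z => |diffQuot a w z| ^ (p - 2) * diffQuot a w z *
        (diffQuot a w - diffQuot a u) z) -
      fun z => |diffQuot a u z| ^ (p - 2) * diffQuot a u z *
        (diffQuot a w - diffQuot a u) z) =
      fun z => (|diffQuot a w z| ^ (p - 2) * diffQuot a w z -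
        |diffQuot a u z| ^ (p - 2) * diffQuot a u z) * (diffQuot a w z - diffQuot a u z) := by
    ext z
    simp only [Pi.sub_apply]
    ring
  have hzero := sub_eq_zero.2 h
  rw [← integral_sub' (integrable_abs_rpow_mul_mul hp hw (hw.sub hu))
    (integrable_abs_rpow_mul_mul hp hu (hw.sub hu)), heq] at hzero
  rw [heq] at hi
  -- By monotonicity the integrand is nonnegative, so a zero integral makes it vanish almost
  -- everywhere; strict monotonicity then equates the two quotients.
  have hae := (integral_eq_zero_iff_of_nonneg (fun z => monotone_pairing_nonneg hp _ _) hi).1 hzero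
  have hd : diffQuot a (w - u) =ᵐ[volume.restrict (Q Ω)] 0 := by
    rw [diffQuot_sub]
    filter_upwards [hae] with z hz
    have := eq_of_monotone_pairing_eq_zero hp hz
    simp [this]
  obtain ⟨c, hc⟩ := ae_eq_const_of_diffQuot hΩ hne ha hd
  refine ⟨c, ?_⟩
  filter_upwards [hc] with x hx
  rw [← hx, Pi.sub_apply]
  ring

end WeakSolution

end FracNeumann

/-! ### The solvability criterion and uniqueness up to constants -/

theorem theorem6p5 {N : ℕ} (Ω : Set (EuclideanSpace ℝ (Fin N)))
    (hΩ : FracNeumann.IsBoundedC1Domain Ω)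
    (s p p' : ℝ) (hs0 : 0 < s) (hs1 : s < 1) (hp : 1 < p) (hpp' : 1 / p + 1 / p' = 1)
    (hN : s * p < N)
    (f g : EuclideanSpace ℝ (Fin N) → ℝ)
    (hf : MemLp f (ENNReal.ofReal p') (volume.restrict Ω))
    (hg : MemLp g ⊤ (volume.restrict Ωᶜ))
    (hgc : ∃ K : Set (EuclideanSpace ℝ (Fin N)), IsCompact K ∧
      ∀ᵐ x ∂(volume.restrict Ωᶜ), x ∉ K → g x = 0) :
    ((∃ u : EuclideanSpace ℝ (Fin N) → ℝ, FracNeumann.IsWeakSolution Ω s p f g u) ↔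
      (∫ x in Ω, f x) + (∫ x in Ωᶜ, g x) = 0) ∧
    (∀ u : EuclideanSpace ℝ (Fin N) → ℝ, FracNeumann.IsWeakSolution Ω s p f g u →
      ∀ w : EuclideanSpace ℝ (Fin N) → ℝ,
        FracNeumann.IsWeakSolution Ω s p f g w ↔
          ∃ c : ℝ, ∀ᵐ x ∂(volume : Measure (EuclideanSpace ℝ (Fin N))), w x = u x + c) := by
  have hne := hΩ.isConnected.nonempty
  have hpq : p.HolderConjugate p' := by
    rw [Real.holderConjugate_iff]
    exact ⟨hp, by simpa using hpp'⟩
  have hsp : 0 < (N : ℝ) + s * p := by positivity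
  have ha : 0 < ((N : ℝ) + s * p) / p := div_pos hsp hpq.pos
  have hiff := fun u => FracNeumann.isWeakSolution_iff hΩ.isOpen hne hΩ.isBounded hpq hsp hf hg hgc
    (u := u)
  obtain ⟨K, hK, hgK⟩ := hgc
  have hh := FracNeumann.memLp_source hΩ.isOpen hf hg hK hgK
  have hB := hΩ.isOpen.measurableSet.union hK.measurableSet
  have hBb := hΩ.isBounded.union hK.isBounded
  have hhB := FracNeumann.ae_source_eq_zero hΩ.isOpen (f := f) hgK
  have hfin : IsFiniteMeasure (volume.restrict (Ω ∪ K)) := ⟨by simpa using hBb.measure_lt_top⟩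
  have htotal := (FracNeumann.integral_source_mul hΩ.isOpen (v := fun _ => 1)
    (FracNeumann.integrable_mul_of_ae_eq_zero hpq hh hB hhB (memLp_const (1 : ℝ)))).2.2
  simp only [mul_one] at htotal
  refine ⟨⟨?_, fun hzero => ?_⟩, fun u hu w => ⟨fun hw => ?_, ?_⟩⟩
  · rintro ⟨u, hu⟩
    -- Constants are admissible test functions and annihilate the left side.
    have h1 := ((hiff u).1 hu).2 (fun _ => 1) aemeasurable_const (by
      rw [FracNeumann.diffQuot_const]
      exact MemLp.zero)
    rw [FracNeumann.diffQuot_const] at h1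
    simp only [Pi.zero_apply, mul_zero, integral_zero, mul_one] at h1
    rw [← htotal, ← h1]
  · obtain ⟨u, hu⟩ := FracNeumann.exists_weak_formulation hΩ.isOpen hne hΩ.isBounded ha hpq hh hB
      hBb hhB (htotal.trans hzero)
    exact ⟨u, (hiff u).2 hu⟩
  · obtain ⟨⟨hum, huq⟩, hu⟩ := (hiff u).1 hu
    obtain ⟨⟨hwm, hwq⟩, hw⟩ := (hiff w).1 hw
    have hsub : MemLp (FracNeumann.diffQuot ((N + s * p) / p) (w - u)) (ENNReal.ofReal p)
        (volume.restrict (FracNeumann.Q Ω)) := by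
      rw [FracNeumann.diffQuot_sub]
      exact hwq.sub huq
    -- Both equations are tested with `w - u`; their right sides coincide.
    have h1 := (hw (w - u) (hwm.sub hum) hsub).trans (hu (w - u) (hwm.sub hum) hsub).symm
    exact FracNeumann.ae_eq_add_const_of_integral_eq hΩ.isOpen hne ha.ne' hp huq hwq
      (mul_left_cancel₀ (by norm_num) h1)
  · rintro ⟨c, hc⟩
    obtain ⟨⟨hum, huq⟩, hu⟩ := (hiff u).1 hu
    have hae := FracNeumann.diffQuot_ae_eq_of_add_const (Ω := Ω) ((N + s * p) / p) hc
    refine (hiff w).2 ⟨⟨(hum.add_const c).congr (hc.mono fun x hx => hx.symm),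
      huq.ae_eq hae.symm⟩, fun v hv hvq => ?_⟩
    rw [← hu v hv hvq]
    congr 1
    refine integral_congr_ae ?_
    filter_upwards [hae] with z hz
    rw [hz]
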